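/- Let $k$ be an algebraic closure of a finite field of characteristic $p$, let $\ell\neq p$ be a prime, and let $\psi:\mathbb{F}_p\to\overline{\mathbb{Q}}_\ell^{*}$ be a non-trivial additive character. An $\ell$-adic sheaf on the spectrum of a field means a continuous finite-dimensional $\overline{\mathbb{Q}}_\ell$-representation of its absolute Galois group; over $k((t))$ or $k((u))$ it is called tamely ramified if the wild inertia group, i.e. the absolute Galois group of the maximal tamely ramified extension, acts trivially. Let $r$ be a positive integer prime to $p$, let $u$ be an $r$-th root of $t$ in a separable closure of $k((t))$, and let $[r]:\operatorname{Spec} k((u))\to\operatorname{Spec} k((t))$ be the covering given by $t=u^r$. Let $$\varphi(u)=\frac{a_{-s}}{u^s}+\dots+\frac{a_{-1}}{u}\in u^{-1}k[u^{-1}]$$ have pole order $s<r$ (with $s=0$ if $\varphi=0$), let $\mathcal{L}_\psi(\varphi(u))$ be the pullback to $\operatorname{Spec}k((u))$ along $\varphi(u)$ of the Artin-Schreier sheaf of $\psi$ on $\mathbb{A}^1$, and let $\mathcal{H}$ be a tamely ramified $\ell$-adic sheaf on $\operatorname{Spec}k((u))$. Then $\operatorname{Tr}_{k((u))/k((t))}(\varphi(u))=0$,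 and the determinant of the $\ell$-adic sheaf $[r]_*(\mathcal{L}_\psi(\varphi(u))\otimes\mathcal{H})$ on $\operatorname{Spec}k((t))$ is tamely ramified. -/

import Mathlib

open scoped PowerSeries LaurentSeries TensorProduct IntermediateField

noncomputable section

namespace Formal

/-! ### Wild inertia -/

section WildInertia

variable (p : ℕ) (A : Type*) [CommRing A] (F : Type*) [Field F] [Algebra A F]
  (Ω : Type*) [Field Ω] [Algebra F Ω] [Algebra A Ω] [IsScalarTower A F Ω]

/-- A subextension `L / F` of `Ω / F` is finite and tamely ramified with respect to the valuation
ring `A` of `F`: the ramification index over `A` of each nonzero prime of the integral closure of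
`A` in `L` is prime to `p`. This is used only when the residue field of `A` is algebraically
closed of characteristic `p`, so that the residue extension is automatically separable. -/
def IsTameExtension (L : IntermediateField F Ω) : Prop :=
  FiniteDimensional F L ∧
    ∀ 𝔓 : Ideal (integralClosure A L), 𝔓.IsPrime → 𝔓 ≠ ⊥ → (𝔓.ramificationIdx A).Coprime p

/-- The maximal tamely ramified extension of `F` in `Ω`: the compositum of all finite tamely
ramified subextensions. -/
def tameClosure : IntermediateField F Ω :=
  ⨆ L : {L : IntermediateField F Ω // IsTameExtension p A F Ω L}, L.1

/-- The wild inertia group: the automorphisms of `Ω` over the maximal tamely ramified extension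
of `F`. -/
def wildInertia : Subgroup (Ω ≃ₐ[F] Ω) :=
  (tameClosure p A F Ω).fixingSubgroup

end WildInertia

/-! ### Representations with coefficients in an algebraic closure of `ℚ_ℓ` -/

section Sheaves

variable {ℓ : ℕ} [Fact ℓ.Prime] {G : Type*} [Group G] {V : Type*} [AddCommGroup V]
  [Module (PadicAlgCl ℓ) V]

/-- Local systems on the spectrum of a field are the continuous finite-dimensional
representations of its absolute Galois group `G`. Continuity of `G → GL(V)` is continuity of all
matrix coefficients. -/
structure IsEllAdic [TopologicalSpace G] (ρ : Representation (PadicAlgCl ℓ) G V) : Prop where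
  finite : FiniteDimensional (PadicAlgCl ℓ) V
  continuous : ∀ (f : Module.Dual (PadicAlgCl ℓ) V) (v : V), Continuous fun σ : G => f (ρ σ v)

/-- A tamely ramified `ℓ`-adic local system: the group `P` (to be the wild inertia group) acts
trivially. -/
structure IsTamelyRamified [TopologicalSpace G] (P : Subgroup G)
    (ρ : Representation (PadicAlgCl ℓ) G V) : Prop extends IsEllAdic ρ where
  tame : ∀ σ ∈ P, ρ σ = 1

/-- The rank one representation given by a character. -/
def charRep (χ : G →* PadicAlgCl ℓ) : Representation (PadicAlgCl ℓ) G (PadicAlgCl ℓ) :=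
  (Module.toModuleEnd (PadicAlgCl ℓ) (S := PadicAlgCl ℓ) (PadicAlgCl ℓ)).toMonoidHom.comp χ

/-- The determinant of a representation, as a rank one representation. -/
def detRep (ρ : Representation (PadicAlgCl ℓ) G V) :
    Representation (PadicAlgCl ℓ) G (PadicAlgCl ℓ) :=
  charRep (LinearMap.det.comp ρ)

end Sheaves

/-! ### Artin-Schreier characters -/

section ArtinSchreier

variable (p : ℕ) [Fact p.Prime] {F : Type*} [Field F] (Ω : Type*) [Field Ω] [CharP Ω p]
  [IsSepClosed Ω] [Algebra F Ω]

theorem exists_artinSchreierRoot (f : F) : ∃ y : Ω, y ^ p - y = algebraMap F Ω f := by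
  obtain ⟨y, hy⟩ := IsSepClosed.exists_root_C_mul_X_pow_add_C_mul_X_add_C' p p (1 : Ω) (-1)
    (-algebraMap F Ω f) dvd_rfl (Fact.out : p.Prime).two_le (by simp)
  exact ⟨y, by linear_combination hy⟩

/-- A root in `Ω` of the Artin-Schreier equation `y ^ p - y = f`. -/
def artinSchreierRoot (f : F) : Ω := (exists_artinSchreierRoot p Ω f).choose

theorem artinSchreierRoot_spec (f : F) :
    artinSchreierRoot p Ω f ^ p - artinSchreierRoot p Ω f = algebraMap F Ω f :=
  (exists_artinSchreierRoot p Ω f).choose_spec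

theorem exists_artinSchreierDiff (f : F) (σ : Ω ≃ₐ[F] Ω) : ∃ a : ZMod p,
    ZMod.castHom dvd_rfl Ω a = σ (artinSchreierRoot p Ω f) - artinSchreierRoot p Ω f := by
  set y := artinSchreierRoot p Ω f with hy
  have h := artinSchreierRoot_spec p Ω f
  rw [← hy] at h
  have h' : σ y ^ p - σ y = algebraMap F Ω f := by
    rw [← map_pow, ← map_sub, h, AlgEquiv.commutes]
  have h2 : (σ y - y) ^ p = σ y - y := by
    rw [sub_pow_char]
    linear_combination h' - h
  rw [← Subfield.mem_bot_iff_pow_eq_self] at h2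
  have h3 : (⊥ : Subfield Ω) ≤ (ZMod.castHom (dvd_refl p) Ω).fieldRange := bot_le
  exact h3 h2

/-- The unique `a ∈ 𝔽_p` with `σ y = y + a`, for the chosen root `y` of `y ^ p - y = f`. -/
def artinSchreierDiff (f : F) (σ : Ω ≃ₐ[F] Ω) : ZMod p := (exists_artinSchreierDiff p Ω f σ).choose

theorem artinSchreierDiff_spec (f : F) (σ : Ω ≃ₐ[F] Ω) :
    ZMod.castHom dvd_rfl Ω (artinSchreierDiff p Ω f σ) =
      σ (artinSchreierRoot p Ω f) - artinSchreierRoot p Ω f :=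
  (exists_artinSchreierDiff p Ω f σ).choose_spec

/-- The homomorphism from the Galois group to `𝔽_p` attached to the torsor `y ^ p - y = f`. -/
def artinSchreierHom (f : F) : (Ω ≃ₐ[F] Ω) →* Multiplicative (ZMod p) where
  toFun σ := .ofAdd (artinSchreierDiff p Ω f σ)
  map_one' := by
    apply Multiplicative.toAdd.injective
    apply (ZMod.castHom (dvd_refl p) Ω).injective
    simp only [toAdd_ofAdd, toAdd_one, map_zero]
    rw [artinSchreierDiff_spec]
    simp
  map_mul' σ τ := by
    apply Multiplicative.toAdd.injective
    apply (ZMod.castHom (dvd_refl p) Ω).injective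
    simp only [toAdd_ofAdd, toAdd_mul, map_add]
    rw [artinSchreierDiff_spec, artinSchreierDiff_spec, artinSchreierDiff_spec]
    have h : τ (artinSchreierRoot p Ω f) = artinSchreierRoot p Ω f +
        ZMod.castHom dvd_rfl Ω (artinSchreierDiff p Ω f τ) := by
      rw [artinSchreierDiff_spec]; ring
    have h' : σ (ZMod.castHom dvd_rfl Ω (artinSchreierDiff p Ω f τ)) =
        ZMod.castHom dvd_rfl Ω (artinSchreierDiff p Ω f τ) :=
      RingHom.congr_fun (RingHom.ext_zmod
        ((σ : Ω →+* Ω).comp (ZMod.castHom (dvd_refl p) Ω)) (ZMod.castHom (dvd_refl p) Ω)) _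
    rw [AlgEquiv.mul_apply, h, map_add, h']
    ring

/-- The sheaf `ℒ_ψ(f)` on `Spec F`, the pullback of the Artin-Schreier sheaf of `ψ` along
`f : Spec F → 𝔸¹`: the rank one representation `σ ↦ ψ (σ y - y)`, where `y ^ p - y = f`. -/
def artinSchreierSheaf {ℓ : ℕ} [Fact ℓ.Prime] (ψ : AddChar (ZMod p) (PadicAlgCl ℓ)) (f : F) :
    Representation (PadicAlgCl ℓ) (Ω ≃ₐ[F] Ω) (PadicAlgCl ℓ) :=
  charRep (ψ.toMonoidHom.comp (artinSchreierHom p Ω f))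

end ArtinSchreier

/-! ### The covering `[r]` of the formal punctured disc -/

section Covering

variable (p : ℕ) (k : Type*) [Field k]

instance charP_separableClosure [CharP k p] : CharP (SeparableClosure k⸨X⸩) p :=
  charP_of_injective_ringHom
    ((algebraMap k⸨X⸩ (SeparableClosure k⸨X⸩)).comp (HahnSeries.C (Γ := ℤ) (R := k))).injective p

/-- The inertia group `I`: the absolute Galois group of `k((t))`. -/
abbrev Inertia : Type _ := SeparableClosure k⸨X⸩ ≃ₐ[k⸨X⸩] SeparableClosure k⸨X⸩

variable {k}

/-- For `u` with `u ^ r = t`, the field `k((u))` is the simple extension `k((t))(u)` of `k((t))`,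
and `[r]` is the covering `Spec k((u)) → Spec k((t))`. This is the absolute Galois group `I(r)` of
`k((u))`. -/
abbrev InertiaCover (u : SeparableClosure k⸨X⸩) : Type _ :=
  SeparableClosure k⸨X⸩ ≃ₐ[k⸨X⸩⟮u⟯] SeparableClosure k⸨X⸩

variable (k) in
/-- The wild inertia group of `k((t))`, with valuation ring `k[[t]]`. -/
def wildSubgroup : Subgroup (Inertia k) :=
  wildInertia p k⟦X⟧ k⸨X⸩ (SeparableClosure k⸨X⸩)

/-- The wild inertia group of `k((u))`, whose valuation ring is the integral closure of
`k[[t]]`. -/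
def wildSubgroupCover (u : SeparableClosure k⸨X⸩) : Subgroup (InertiaCover u) :=
  wildInertia p (integralClosure k⟦X⟧ k⸨X⸩⟮u⟯) k⸨X⸩⟮u⟯ (SeparableClosure k⸨X⸩)

/-- The element of `k((u))` obtained by substituting `u⁻¹` into the polynomial `φ`. -/
def evalInv (u : SeparableClosure k⸨X⸩) (φ : Polynomial k) : k⸨X⸩⟮u⟯ :=
  φ.eval₂ ((algebraMap k⸨X⸩ k⸨X⸩⟮u⟯).comp HahnSeries.C) (IntermediateField.AdjoinSimple.gen k⸨X⸩ u)⁻¹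

/-- The pushforward of local systems along `Spec k((u)) → Spec k((t))`: induction of
representations from `I(r)` to `I`. -/
abbrev pushforward {ℓ : ℕ} [Fact ℓ.Prime] (u : SeparableClosure k⸨X⸩) {V : Type*} [AddCommGroup V]
    [Module (PadicAlgCl ℓ) V] (ρ : Representation (PadicAlgCl ℓ) (InertiaCover u) V) :=
  Representation.ind (AlgEquiv.restrictScalarsHom k⸨X⸩ : InertiaCover u →* Inertia k) ρ

end Covering

end Formal

end

namespace Ideal

theorem ramificationIdx_map_algEquiv {R S T : Type*} [CommRing R] [CommRing S] [CommRing T]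
    [Algebra R S] [Algebra R T] (e : S ≃ₐ[R] T) (q : Ideal S) [q.IsPrime] :
    (q.map e).ramificationIdx R = q.ramificationIdx R := by
  have hq' : (q.map e).IsPrime := map_isPrime_of_equiv e
  let : Algebra S T := e.toAlgHom.toRingHom.toAlgebra
  have : IsScalarTower R S T := IsScalarTower.of_algHom e.toAlgHom
  have hb : Function.Bijective (algebraMap S T) := e.bijective
  have : (q.map e).LiesOver q := ⟨(comap_map_of_bijective e e.bijective).symm⟩
  have : Algebra.FormallyUnramified S T :=
    Algebra.FormallyUnramified.of_surjective (Algebra.ofId S T) hb.2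
  have : Module.Flat S T :=
    Module.Flat.of_linearEquiv (AlgEquiv.ofBijective (Algebra.ofId S T) hb).symm.toLinearEquiv
  have : Module.Finite S T :=
    Module.Finite.equiv (AlgEquiv.ofBijective (Algebra.ofId S T) hb).toLinearEquiv
  rw [ramificationIdx_tower q, ramificationIdx_eq_one (q.map e) S, mul_one]

theorem exists_ramificationIdx_tower {R S T : Type*} [CommRing R] [CommRing S] [CommRing T]
    [Algebra R S] [Algebra R T] [Algebra S T] [IsScalarTower R S T] [IsDedekindDomain S]
    [IsDomain T] [Module.IsTorsionFree S T] [Algebra.IsIntegral S T] (P : Ideal T) [P.IsPrime]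
    (hP : P ≠ ⊥) : ∃ Q : Ideal S, Q.IsPrime ∧ Q ≠ ⊥ ∧
      P.ramificationIdx R = Q.ramificationIdx R * P.ramificationIdx S :=
  ⟨P.under S, inferInstance, fun h => hP (eq_bot_of_comap_eq_bot h), ramificationIdx_tower _ _⟩

theorem coprime_ramificationIdx_integralClosure {n : ℕ} {A B L : Type*} [CommRing A] [CommRing B]
    [IsDedekindDomain B] [Field L] [Algebra A B] [Algebra B L] [Algebra A L] [IsScalarTower A B L]
    [FaithfulSMul B L] [Algebra.IsIntegral A B]
    (hB : ∀ Q : Ideal B, Q.IsPrime → Q ≠ ⊥ → (Q.ramificationIdx A).Coprime n)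
    (hL : ∀ P : Ideal (integralClosure B L), P.IsPrime → P ≠ ⊥ → (P.ramificationIdx B).Coprime n)
    (P : Ideal (integralClosure A L)) (hP : P.IsPrime) (hP0 : P ≠ ⊥) :
    (P.ramificationIdx A).Coprime n := by
  let e : integralClosure A L ≃ₐ[A] integralClosure B L :=
    { toFun x := ⟨x.1, x.2.tower_top⟩
      invFun x := ⟨x.1, isIntegral_trans _ x.2⟩
      left_inv _ := rfl
      right_inv _ := rfl
      map_mul' _ _ := rfl
      map_add' _ _ := rfl
      commutes' _ := rfl }
  rw [← ramificationIdx_map_algEquiv e P]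
  have hP' := map_isPrime_of_equiv e (I := P)
  have hP0' : P.map e ≠ ⊥ := by rwa [Ne, map_eq_bot_iff_of_injective e.injective]
  obtain ⟨Q, hQ, hQ0, h⟩ := exists_ramificationIdx_tower (R := A) (S := B) (P.map e) hP0'
  rw [h]
  exact Nat.Coprime.mul_left (hB Q hQ hQ0) (hL _ hP' hP0')

end Ideal

namespace Formal
section
variable {p : ℕ} {A : Type*} [CommRing A] {F : Type*} [Field F] [Algebra A F]
  {Ω : Type*} [Field Ω] [Algebra F Ω] [Algebra A Ω] [IsScalarTower A F Ω]

theorem mem_wildInertia_iff {σ : Ω ≃ₐ[F] Ω} : σ ∈ wildInertia p A F Ω ↔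
    ∀ L : IntermediateField F Ω, IsTameExtension p A F Ω L → ∀ x ∈ L, σ x = x := by
  rw [wildInertia, tameClosure, ← Subgroup.zpowers_le, ← IntermediateField.le_iff_le, iSup_le_iff,
    Subtype.forall]
  refine forall₂_congr fun L hL => ?_
  rw [IntermediateField.le_iff_le, Subgroup.zpowers_le, IntermediateField.mem_fixingSubgroup_iff]

theorem IsTameExtension.map {L : IntermediateField F Ω} (hL : IsTameExtension p A F Ω L)
    (σ : Ω ≃ₐ[F] Ω) : IsTameExtension p A F Ω (L.map (σ : Ω →ₐ[F] Ω)) := by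
  obtain ⟨hfin, h⟩ := hL
  let e : L ≃ₐ[F] L.map (σ : Ω →ₐ[F] Ω) := L.equivMap _
  refine ⟨Module.Finite.equiv e.toLinearEquiv, fun P hP hP0 => ?_⟩
  let e' : integralClosure A (L.map (σ : Ω →ₐ[F] Ω)) ≃ₐ[A] integralClosure A L :=
    (e.symm.restrictScalars A).mapIntegralClosure
  rw [← Ideal.ramificationIdx_map_algEquiv e' P]
  exact h _ (Ideal.map_isPrime_of_equiv e') (by
    rwa [Ne, Ideal.map_eq_bot_iff_of_injective e'.injective])

theorem wildInertia_normal : (wildInertia p A F Ω).Normal := by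
  constructor
  intro σ hσ τ
  rw [mem_wildInertia_iff] at hσ ⊢
  intro L hL x hx
  have := hσ _ (hL.map τ⁻¹) (τ⁻¹ x) ⟨x, hx, rfl⟩
  rw [AlgEquiv.mul_apply, AlgEquiv.mul_apply, this, ← AlgEquiv.mul_apply, mul_inv_cancel]
  rfl

theorem IsTameExtension.restrictScalars [IsDedekindDomain A] [IsFractionRing A F]
    [Algebra.IsSeparable F Ω] {M : IntermediateField F Ω} (hM : IsTameExtension p A F Ω M)
    {L : IntermediateField M Ω} (hL : IsTameExtension p (integralClosure A M) M Ω L) :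
    IsTameExtension p A F Ω (L.restrictScalars F) := by
  obtain ⟨hMf, hM⟩ := hM
  obtain ⟨hLf, hL⟩ := hL
  have : FiniteDimensional F L := FiniteDimensional.trans F M L
  refine ⟨this, fun P hP hP0 => ?_⟩
  have : IsScalarTower A M Ω := IsScalarTower.of_algebraMap_eq fun x => by
    rw [IsScalarTower.algebraMap_apply A F M, ← IsScalarTower.algebraMap_apply F M Ω,
      IsScalarTower.algebraMap_apply A F Ω]
  let : Algebra (integralClosure A M) (L.restrictScalars F) :=
    inferInstanceAs (Algebra (integralClosure A M) L)
  have : IsScalarTower A (integralClosure A M) (L.restrictScalars F) :=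
    IsScalarTower.of_algebraMap_eq fun x =>
      Subtype.ext (IsScalarTower.algebraMap_apply A M Ω x)
  have := integralClosure.isDedekindDomain A F M
  have : FaithfulSMul (integralClosure A M) (L.restrictScalars F) := by
    rw [faithfulSMul_iff_algebraMap_injective]
    exact (algebraMap M L).injective.comp Subtype.val_injective
  have h := @Ideal.coprime_ramificationIdx_integralClosure p A (integralClosure A M)
    (L.restrictScalars F) _ _ _ _ _ _ _ _ _ _ hM
  exact h hL P hP hP0

theorem isTameExtension_of_isGalois [IsDedekindDomain A] [IsFractionRing A F]
    {M : IntermediateField F Ω} [FiniteDimensional F M] [IsGalois F M]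
    (hM : (Module.finrank F M).Coprime p) : IsTameExtension p A F Ω M := by
  refine ⟨inferInstance, fun P hP hP0 => ?_⟩
  refine Nat.Coprime.of_dvd_left ?_ hM
  let := IsIntegralClosure.MulSemiringAction A F M (integralClosure A M)
  have := integralClosure.isFractionRing_of_finite_extension (A := A) F M
  have := IsIntegralClosure.finite A F M (integralClosure A M)
  have := integralClosure.isDedekindDomain A F M
  have : IsScalarTower A M Ω := IsScalarTower.of_algebraMap_eq fun x => by
    rw [IsScalarTower.algebraMap_apply A F M, ← IsScalarTower.algebraMap_apply F M Ω,
      IsScalarTower.algebraMap_apply A F Ω]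
  have : FaithfulSMul A M := by
    rw [faithfulSMul_iff_algebraMap_injective, IsScalarTower.algebraMap_eq A F M]
    exact (algebraMap F M).injective.comp (IsFractionRing.injective A F)
  have : IsGaloisGroup Gal(M/F) A (integralClosure A M) :=
    IsGaloisGroup.of_isFractionRing _ A _ F M
  have h := Ideal.ncard_primesOver_mul_ramificationIdxIn_mul_inertiaDegIn (P.under A)
    (integralClosure A M) Gal(M/F)
  rw [Ideal.ramificationIdxIn_eq_ramificationIdx (P.under A) P Gal(M/F),
    IsGaloisGroup.card_eq_finrank Gal(M/F) F M] at h
  exact h ▸ (dvd_mul_right _ _).mul_left _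
end
end Formal

namespace Representation

section Ind

variable {k G H ι V : Type*} [Field k] [Group G] [Group H] (φ : G →* H) [AddCommGroup V]
  [Module k V] (ρ : Representation k G V) (c : ι → H)

theorem IndV.mk_mul (g : G) (h : H) (v : V) :
    IndV.mk φ ρ (φ g * h) (ρ g v) = IndV.mk φ ρ h v := by
  have := Coinvariants.mk_self_apply (Representation.tprod ((leftRegular k H).comp φ) ρ) g
    (MonoidAlgebra.single h 1 ⊗ₜ v)
  simpa using this

variable {c} in
theorem ind_apply_mk_of_map_eq {g : G} {i : ι} {σ : H} (hg : φ g = c i * σ * (c i)⁻¹) (v : V) :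
    ind φ ρ σ (IndV.mk φ ρ (c i) v) = IndV.mk φ ρ (c i) (ρ g v) := by
  rw [ind_mk, ← IndV.mk_mul φ ρ g, hg]
  congr 2
  group

variable [Fintype ι] [DecidableEq ι]

/-- If every element of `H` is uniquely of the form `φ g * c i`, the induced representation is the
direct sum of the copies `IndV.mk φ ρ (c i)` of `V`. -/
noncomputable def indVEquivPi (hc : Function.Bijective fun x : G × ι => φ x.1 * c x.2) :
    (ι → V) ≃ₗ[k] IndV φ ρ :=
  let e := Equiv.ofBijective _ hc
  have he (h : H) : φ (e.symm h).1 * c (e.symm h).2 = h := e.apply_symm_apply h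
  have he' (g : G) (h : H) : e.symm (φ g * h) = (g * (e.symm h).1, (e.symm h).2) := by
    rw [Equiv.symm_apply_eq]
    simp [e, mul_assoc, he]
  LinearEquiv.ofLinearMap (∑ i, IndV.mk φ ρ (c i) ∘ₗ LinearMap.proj i)
    (Coinvariants.lift _ (TensorProduct.lift
      ((Finsupp.lift _ _ _ fun h =>
        LinearMap.single k (fun _ => V) (e.symm h).2 ∘ₗ ρ (e.symm h).1⁻¹) ∘ₗ
        (MonoidAlgebra.coeffLinearEquiv k).toLinearMap)) fun g => by
      ext h v : 5
      simp [he', ← Module.End.mul_apply, ← map_mul])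
    (by
      ext h v
      have hv := IndV.mk_mul φ ρ (e.symm h).1 (c (e.symm h).2) (ρ (e.symm h).1⁻¹ v)
      rw [he, ρ.self_inv_apply] at hv
      simp only [MonoidAlgebra.lsingle_apply, LinearMap.coe_comp, Function.comp_apply] at hv ⊢
      simp
      rw [Finset.sum_eq_single_of_mem (e.symm h).2 (Finset.mem_univ _) fun j _ hj => by
        simp [Pi.single_eq_of_ne hj], Pi.single_eq_same]
      exact hv.symm)
    (by
      have hi (i : ι) : e.symm (c i) = (1, i) := by simp [Equiv.symm_apply_eq, e]
      ext i v j
      simp [hi, Pi.single_apply, Finset.sum_ite_eq])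

theorem indVEquivPi_apply (hc : Function.Bijective fun x : G × ι => φ x.1 * c x.2) (f : ι → V) :
    indVEquivPi φ ρ c hc f = ∑ i, IndV.mk φ ρ (c i) (f i) := by
  simp [indVEquivPi]

theorem det_ind [FiniteDimensional k V] (hc : Function.Bijective fun x : G × ι => φ x.1 * c x.2)
    {σ : H} {g : ι → G} (hg : ∀ i, φ (g i) = c i * σ * (c i)⁻¹) :
    LinearMap.det (ind φ ρ σ) = ∏ i, LinearMap.det (ρ (g i)) := by
  rw [← LinearMap.det_pi, ← LinearMap.det_conj _ (indVEquivPi φ ρ c hc)]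
  congr 1
  rw [← LinearMap.comp_assoc, LinearEquiv.eq_comp_toLinearMap_symm]
  ext i v
  have h := indVEquivPi_apply φ ρ c hc
  simp only [LinearMap.comp_apply, LinearEquiv.coe_coe, h, map_sum]
  exact Finset.sum_congr rfl fun j _ => ind_apply_mk_of_map_eq φ ρ (hg j) _

end Ind
end Representation

namespace Formal

section

variable {ℓ : ℕ} [Fact ℓ.Prime] {G : Type*} [Group G] [TopologicalSpace G] {V : Type*}
  [AddCommGroup V] [Module (PadicAlgCl ℓ) V]

theorem isEllAdic_charRep {χ : G →* PadicAlgCl ℓ} (hχ : Continuous χ) :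
    IsEllAdic (charRep χ) where
  finite := inferInstance
  continuous f v := by
    have (σ : G) : f (charRep χ σ v) = χ σ * f v := by
      rw [← smul_eq_mul, ← map_smul]
      rfl
    simp_rw [this]
    fun_prop

theorem IsEllAdic.detRep {ρ : Representation (PadicAlgCl ℓ) G V} (h : IsEllAdic ρ) :
    IsEllAdic (detRep ρ) := by
  have := h.finite
  refine isEllAdic_charRep ?_
  let b := Module.finBasis (PadicAlgCl ℓ) V
  have (σ : G) : LinearMap.det (ρ σ) =
      (Matrix.of fun i j => b.coord i (ρ σ (b j))).det := by
    rw [← LinearMap.det_toMatrix b]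
    congr 1
    ext i j
    simp [LinearMap.toMatrix_apply]
  simp only [MonoidHom.coe_comp, Function.comp_def, this]
  exact Continuous.matrix_det (continuous_matrix fun i j => h.continuous (b.coord i) (b j))

theorem IsEllAdic.charRep_tprod {χ : G →* PadicAlgCl ℓ} (hχ : Continuous χ)
    {ρ : Representation (PadicAlgCl ℓ) G V} (h : IsEllAdic ρ) :
    IsEllAdic ((charRep χ).tprod ρ) where
  finite := have := h.finite; inferInstance
  continuous f v := by
    induction v with
    | zero => simpa using continuous_const
    | add x y hx hy => simpa only [map_add] using hx.fun_add hy
    | tmul a v =>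
      have (σ : G) : f ((charRep χ).tprod ρ σ (a ⊗ₜ v)) =
          χ σ * (f ∘ₗ TensorProduct.mk (PadicAlgCl ℓ) _ V a) (ρ σ v) := by
        rw [← smul_eq_mul, ← map_smul]
        exact congrArg f (TensorProduct.smul_tmul (χ σ) a (ρ σ v))
      simp_rw [this]
      exact hχ.mul (h.continuous _ _)

theorem continuous_of_tendsto_nhds_one [IsTopologicalGroup G]
    {ρ : Representation (PadicAlgCl ℓ) G V}
    (h : ∀ (f : Module.Dual (PadicAlgCl ℓ) V) (v : V),
      Filter.Tendsto (fun σ : G => f (ρ σ v)) (nhds 1) (nhds (f v)))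
    (f : Module.Dual (PadicAlgCl ℓ) V) (v : V) : Continuous fun σ : G => f (ρ σ v) := by
  refine continuous_iff_continuousAt.2 fun σ => ?_
  rw [ContinuousAt, ← map_mul_left_nhds_one, Filter.tendsto_map'_iff]
  simpa [Function.comp_def] using h (f ∘ₗ ρ σ) v

theorem IsEllAdic.ind {H : Type*} [Group H] [TopologicalSpace H] [IsTopologicalGroup H]
    {φ : G →* H} (hφ : nhds 1 ≤ Filter.map φ (nhds 1)) {ι : Type*} [Finite ι] {c : ι → H}
    (hc : Function.Bijective fun x : G × ι => φ x.1 * c x.2)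
    {ρ : Representation (PadicAlgCl ℓ) G V} (h : IsEllAdic ρ) :
    IsEllAdic (Representation.ind φ ρ) := by
  classical
  have := Fintype.ofFinite ι
  have := h.finite
  let e := Representation.indVEquivPi φ ρ c hc
  refine ⟨e.finiteDimensional, continuous_of_tendsto_nhds_one fun f v => ?_⟩
  obtain ⟨w, rfl⟩ := e.surjective v
  simp only [e, Representation.indVEquivPi_apply, map_sum]
  refine tendsto_finsetSum _ fun i _ => ?_
  have hconj : Filter.Tendsto (fun σ => c i * σ * (c i)⁻¹) (nhds 1) (nhds 1) :=
    Continuous.tendsto' (by fun_prop) _ _ (by simp)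
  have key : Filter.Tendsto (fun τ => f (Representation.ind φ ρ ((c i)⁻¹ * τ * c i)
      (Representation.IndV.mk φ ρ (c i) (w i)))) (nhds 1)
      (nhds (f (Representation.IndV.mk φ ρ (c i) (w i)))) := by
    refine Filter.Tendsto.mono_left (Filter.tendsto_map'_iff.2 ?_) hφ
    have := (h.continuous (f ∘ₗ Representation.IndV.mk φ ρ (c i)) (w i)).tendsto 1
    rw [map_one] at this
    refine this.congr fun g => ?_
    rw [Function.comp_apply, Representation.ind_apply_mk_of_map_eq φ ρ (g := g) (by group)]
    rfl
  refine (key.comp hconj).congr fun σ => ?_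
  simp only [Function.comp_apply]
  congr 3
  group

end
end Formal

namespace IntermediateField

section Kummer

open Polynomial

variable {F Ω : Type*} [Field F] [Field Ω] [Algebra F Ω] {n : ℕ} {ζ a : F} {u : Ω}

theorem finrank_adjoin_of_pow_eq (ha : Irreducible (X ^ n - C a)) (hu : u ^ n = algebraMap F Ω a) :
    Module.finrank F F⟮u⟯ = n := by
  have hn := ne_zero_of_irreducible_X_pow_sub_C ha
  have hm : X ^ n - C a = minpoly F u :=
    minpoly.eq_of_irreducible_of_monic ha (by simp [hu]) (monic_X_pow_sub_C a hn)
  have hint : IsIntegral F u := ⟨_, monic_X_pow_sub_C a hn, by simp [hu]⟩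
  rw [adjoin.finrank hint, ← hm, natDegree_X_pow_sub_C]

theorem gen_pow_eq (hu : u ^ n = algebraMap F Ω a) :
    AdjoinSimple.gen F u ^ n = algebraMap F F⟮u⟯ a :=
  Subtype.ext hu

theorem isSplittingField_adjoin_of_pow_eq (hζ : IsPrimitiveRoot ζ n)
    (ha : Irreducible (X ^ n - C a)) (hu : u ^ n = algebraMap F Ω a) :
    IsSplittingField F F⟮u⟯ (X ^ n - C a) := by
  have hn := Nat.pos_of_ne_zero (ne_zero_of_irreducible_X_pow_sub_C ha)
  have hr := finrank_adjoin_of_pow_eq ha hu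
  have : FiniteDimensional F F⟮u⟯ := Module.finite_of_finrank_pos (hr ▸ hn)
  have hint : IsIntegral F u := ⟨_, monic_X_pow_sub_C a hn.ne', by simp [hu]⟩
  have htop : F⟮AdjoinSimple.gen F u⟯ = ⊤ := by
    have := (adjoin.powerBasis hint).adjoin_gen_eq_top
    rw [adjoin.powerBasis_gen] at this
    exact (eq_adjoin_of_eq_algebra_adjoin _ _ _ this.symm).symm
  have h := isSplittingField_X_pow_sub_C_of_root_adjoin_eq_top (K := F) (a := a)
    (α := AdjoinSimple.gen F u) (by rw [hr]; exact ⟨ζ, (mem_primitiveRoots hn).2 hζ⟩)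
    (by rw [hr, gen_pow_eq hu]) htop
  rwa [hr] at h

theorem isGalois_adjoin_of_pow_eq (hζ : IsPrimitiveRoot ζ n)
    (ha : Irreducible (X ^ n - C a)) (hu : u ^ n = algebraMap F Ω a) : IsGalois F F⟮u⟯ := by
  have := isSplittingField_adjoin_of_pow_eq hζ ha hu
  have hn := Nat.pos_of_ne_zero (ne_zero_of_irreducible_X_pow_sub_C ha)
  exact isGalois_of_isSplittingField_X_pow_sub_C ⟨ζ, (mem_primitiveRoots hn).2 hζ⟩ ha _

theorem trace_gen_inv_pow_eq_zero (hζ : IsPrimitiveRoot ζ n)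
    (ha : Irreducible (X ^ n - C a)) (hu : u ^ n = algebraMap F Ω a) {i : ℕ} (hi : i ≠ 0)
    (hin : i < n) : Algebra.trace F F⟮u⟯ ((AdjoinSimple.gen F u)⁻¹ ^ i) = 0 := by
  have := isSplittingField_adjoin_of_pow_eq hζ ha hu
  have : NeZero n := ⟨by lia⟩
  let τ := (autEquivZmod ha F⟮u⟯ hζ).symm (.ofAdd ((1 : ℕ) : ZMod n))
  have hτ : τ (AdjoinSimple.gen F u) = ζ • AdjoinSimple.gen F u := by
    rw [autEquivZmod_symm_apply_natCast ha F⟮u⟯ (gen_pow_eq hu) hζ 1, pow_one]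
  have hτ' : τ ((AdjoinSimple.gen F u)⁻¹ ^ i) = (ζ⁻¹ ^ i) • (AdjoinSimple.gen F u)⁻¹ ^ i := by
    rw [map_pow, map_inv₀, hτ, Algebra.smul_def, Algebra.smul_def, mul_inv, mul_pow, map_pow,
      map_inv₀]
  have h := Algebra.trace_eq_of_algEquiv τ ((AdjoinSimple.gen F u)⁻¹ ^ i)
  rw [hτ', map_smul, smul_eq_mul, ← sub_eq_zero, ← sub_one_mul, mul_eq_zero, sub_eq_zero] at h
  exact h.resolve_left (hζ.inv.pow_ne_one_of_pos_of_lt hi hin)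

end Kummer

section Restrict

variable {F Ω : Type*} [Field F] [Field Ω] [Algebra F Ω] (M : IntermediateField F Ω)

theorem exists_restrictScalarsHom_eq {σ : Ω ≃ₐ[F] Ω} (hσ : ∀ x ∈ M, σ x = x) :
    ∃ g : Ω ≃ₐ[M] Ω, AlgEquiv.restrictScalarsHom F g = σ :=
  ⟨fixingSubgroupEquiv M ⟨σ, (mem_fixingSubgroup_iff _ _).2 hσ⟩, rfl⟩

theorem nhds_one_le_map_restrictScalarsHom [FiniteDimensional F M] :
    nhds 1 ≤ Filter.map (AlgEquiv.restrictScalarsHom F : (Ω ≃ₐ[M] Ω) →* (Ω ≃ₐ[F] Ω)) (nhds 1) := by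
  intro s hs
  obtain ⟨E, hE, h⟩ := (krullTopology_mem_nhds_one_iff M Ω _).1 hs
  have : FiniteDimensional F E := FiniteDimensional.trans F M E
  refine (krullTopology_mem_nhds_one_iff F Ω _).2 ⟨E.restrictScalars F, this, fun σ hσ => ?_⟩
  rw [SetLike.mem_coe, mem_fixingSubgroup_iff] at hσ
  obtain ⟨g, rfl⟩ := exists_restrictScalarsHom_eq M (σ := σ) fun x hx =>
    hσ x (E.algebraMap_mem ⟨x, hx⟩)
  exact h ((mem_fixingSubgroup_iff _ _).2 hσ)

theorem exists_section_restrict [Normal F Ω] [Normal F M] :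
    ∃ c : Gal(M/F) → Gal(Ω/F), (∀ (τ : Gal(M/F)) (x : M), c τ x = τ x) ∧
      Function.Bijective fun x : (Ω ≃ₐ[M] Ω) × Gal(M/F) =>
        AlgEquiv.restrictScalarsHom F x.1 * c x.2 := by
  have hc (τ : Gal(M/F)) (x : M) : τ.liftNormal Ω x = τ x := τ.liftNormal_commutes Ω x
  refine ⟨fun τ => τ.liftNormal Ω, hc, ?_, fun σ => ?_⟩
  · rintro ⟨g, τ⟩ ⟨g', τ'⟩ h
    dsimp only at h
    have h1 : τ = τ' := by
      ext x
      have := DFunLike.congr_fun h (x : Ω)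
      have e (g : Ω ≃ₐ[M] Ω) (τ : Gal(M/F)) :
          (AlgEquiv.restrictScalarsHom F g * τ.liftNormal Ω) x = τ x := by
        rw [AlgEquiv.mul_apply, hc]
        exact g.commutes (τ x)
      rw [← e g τ, ← e g' τ', this]
    subst h1
    have h2 := mul_right_cancel h
    simp only [Prod.mk.injEq, and_true]
    ext x
    exact DFunLike.congr_fun h2 x
  · let τ := σ.restrictNormal M
    obtain ⟨g, hg⟩ := exists_restrictScalarsHom_eq M (σ := σ * (τ.liftNormal Ω)⁻¹) fun x hx => by
      have h : (τ.liftNormal Ω)⁻¹ x = (τ⁻¹ ⟨x, hx⟩ : M) := by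
        rw [AlgEquiv.aut_inv, AlgEquiv.symm_apply_eq, hc, ← AlgEquiv.mul_apply, mul_inv_cancel]
        rfl
      rw [AlgEquiv.mul_apply, h, ← AlgEquiv.restrictNormal_apply, ← AlgEquiv.mul_apply,
        mul_inv_cancel]
      rfl
    exact ⟨(g, τ), by simp [hg]⟩

end Restrict

end IntermediateField

namespace Formal

open IntermediateField

theorem mem_wildInertia_of_restrictScalarsHom {p : ℕ} {A : Type*} [CommRing A] {F : Type*} [Field F]
    [Algebra A F] {Ω : Type*} [Field Ω] [Algebra F Ω] [Algebra A Ω] [IsScalarTower A F Ω]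
    [IsDedekindDomain A] [IsFractionRing A F] [Algebra.IsSeparable F Ω] {M : IntermediateField F Ω}
    (hM : IsTameExtension p A F Ω M) {g : Ω ≃ₐ[M] Ω}
    (hg : AlgEquiv.restrictScalarsHom F g ∈ wildInertia p A F Ω) :
    g ∈ wildInertia p (integralClosure A M) M Ω := by
  rw [mem_wildInertia_iff] at hg ⊢
  exact fun L hL x hx => hg _ (hM.restrictScalars hL) x hx

section ArtinSchreier

theorem algEquiv_castHom {p : ℕ} {F Ω : Type*} [Field F] [Field Ω] [CharP Ω p] [Algebra F Ω]
    (σ : Ω ≃ₐ[F] Ω) (a : ZMod p) :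
    σ (ZMod.castHom dvd_rfl Ω a) = ZMod.castHom dvd_rfl Ω a :=
  RingHom.congr_fun (RingHom.ext_zmod
    ((σ : Ω →+* Ω).comp (ZMod.castHom (dvd_refl p) Ω)) (ZMod.castHom (dvd_refl p) Ω)) _

variable {p : ℕ} [Fact p.Prime] {F Ω : Type*} [Field F] [Field Ω] [CharP Ω p] [Algebra F Ω]

theorem exists_castHom_eq {y : Ω} (hy : y ^ p - y = 0) :
    ∃ a : ZMod p, ZMod.castHom dvd_rfl Ω a = y := by
  rw [sub_eq_zero, ← Subfield.mem_bot_iff_pow_eq_self] at hy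
  exact (bot_le : ⊥ ≤ (ZMod.castHom (dvd_refl p) Ω).fieldRange) hy

variable [IsSepClosed Ω]

theorem continuous_artinSchreier [Algebra.IsIntegral F Ω] {X : Type*} [Monoid X]
    [TopologicalSpace X] (ψ : Multiplicative (ZMod p) →* X) (f : F) :
    Continuous (ψ.comp (artinSchreierHom p Ω f)) := by
  refine continuous_iff_continuousAt.2 fun σ => ?_
  rw [ContinuousAt, ← map_mul_left_nhds_one, Filter.tendsto_map'_iff]
  refine tendsto_const_nhds.congr' ?_
  have := (stabilizer_isOpen_of_isIntegral (K := F) (artinSchreierRoot p Ω f)).mem_nhds (one_mem _)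
  filter_upwards [this] with τ hτ
  have h1 : artinSchreierHom p Ω f τ = 1 := by
    apply Multiplicative.toAdd.injective
    apply (ZMod.castHom (dvd_refl p) Ω).injective
    rw [toAdd_one, map_zero]
    exact (artinSchreierDiff_spec p Ω f τ).trans (sub_eq_zero.2 hτ)
  simp [h1]

theorem sum_artinSchreierDiff_conj {M : IntermediateField F Ω} [FiniteDimensional F M]
    [IsGalois F M] {f : M} (hf : Algebra.trace F M f = 0) {c : Gal(M/F) → Gal(Ω/F)}
    (hc : ∀ (τ : Gal(M/F)) (x : M), c τ x = τ x) {σ : Gal(Ω/F)} {g : Gal(M/F) → (Ω ≃ₐ[M] Ω)}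
    (hg : ∀ τ, AlgEquiv.restrictScalarsHom F (g τ) = c τ * σ * (c τ)⁻¹) :
    ∑ τ, artinSchreierDiff p Ω f (g τ) = 0 := by
  let y := artinSchreierRoot p Ω f
  have hy : y ^ p - y = f := artinSchreierRoot_spec p Ω f
  let Y := ∑ τ, (c τ)⁻¹ y
  have hY : Y ^ p - Y = 0 := by
    have h1 (τ : Gal(M/F)) : ((c τ)⁻¹ y) ^ p - (c τ)⁻¹ y = (τ⁻¹ f : M) := by
      rw [← map_pow, ← map_sub, hy, AlgEquiv.aut_inv, AlgEquiv.symm_apply_eq, hc,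
        ← AlgEquiv.mul_apply, mul_inv_cancel]
      rfl
    rw [sum_pow_char, ← Finset.sum_sub_distrib, Finset.sum_congr rfl fun τ _ => h1 τ]
    have h2 := trace_eq_sum_automorphisms (K := F) f
    rw [hf, map_zero, ← Equiv.sum_comp (Equiv.inv _)] at h2
    simpa using congrArg (algebraMap M Ω) h2.symm
  apply (ZMod.castHom (dvd_refl p) Ω).injective
  have h3 (τ : Gal(M/F)) : ZMod.castHom (dvd_refl p) Ω (artinSchreierDiff p Ω f (g τ)) =
      σ ((c τ)⁻¹ y) - (c τ)⁻¹ y := by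
    have h : g τ y = c τ (σ ((c τ)⁻¹ y)) := DFunLike.congr_fun (hg τ) y
    rw [← algEquiv_castHom (c τ)⁻¹, artinSchreierDiff_spec, map_sub, h, ← AlgEquiv.mul_apply,
      inv_mul_cancel]
    rfl
  obtain ⟨b, hb⟩ := exists_castHom_eq hY
  rw [map_sum, Finset.sum_congr rfl fun τ _ => h3 τ, Finset.sum_sub_distrib, ← map_sum, map_zero,
    sub_eq_zero]
  change σ Y = Y
  rw [← hb, algEquiv_castHom]

end ArtinSchreier

end Formal

namespace Formal

open Polynomial in
theorem irreducible_X_pow_sub_C_single (k : Type*) [Field k] {r : ℕ} (hr : r ≠ 0) :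
    Irreducible (X ^ r - C (HahnSeries.single 1 1 : k⸨X⸩)) := by
  have hm : (X ^ r - C (PowerSeries.X : k⟦X⟧)).Monic := monic_X_pow_sub_C _ hr
  have hp : (Ideal.span {(PowerSeries.X : k⟦X⟧)}).IsPrime := PowerSeries.span_X_isPrime
  have he : (X ^ r - C (PowerSeries.X : k⟦X⟧)).IsEisensteinAt (Ideal.span {PowerSeries.X}) := by
    refine hm.isEisensteinAt_of_mem_of_notMem hp.ne_top (fun {i} hi => ?_) ?_
    · rw [natDegree_X_pow_sub_C] at hi
      rw [coeff_sub, coeff_X_pow, if_neg hi.ne, zero_sub, coeff_C]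
      split_ifs
      · exact neg_mem (Ideal.mem_span_singleton_self _)
      · simp
    · rw [coeff_sub, coeff_X_pow, if_neg hr.symm, zero_sub, coeff_C_zero, neg_mem_iff,
        Ideal.span_singleton_pow, Ideal.mem_span_singleton]
      intro h
      have := PowerSeries.X_pow_dvd_iff.1 h 1 (by norm_num)
      simp at this
  have hirr := he.irreducible hp hm.isPrimitive (by rw [natDegree_X_pow_sub_C]; lia)
  have := (hm.irreducible_iff_irreducible_map_fraction_map (K := k⸨X⸩)).1 hirr
  simpa [HahnSeries.ofPowerSeries_X] using this

theorem isTameExtension_adjoin {p : ℕ} {k : Type*} [Field k] {r : ℕ} (hr : r.Coprime p)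
    (hr0 : r ≠ 0) {ζ : k⸨X⸩} (hζ : IsPrimitiveRoot ζ r) {u : SeparableClosure k⸨X⸩}
    (hu : u ^ r = algebraMap k⸨X⸩ (SeparableClosure k⸨X⸩) (HahnSeries.single 1 1)) :
    IsTameExtension p k⟦X⟧ k⸨X⸩ (SeparableClosure k⸨X⸩) k⸨X⸩⟮u⟯ := by
  have hirr := irreducible_X_pow_sub_C_single k hr0
  have hrank := IntermediateField.finrank_adjoin_of_pow_eq hirr hu
  have := IntermediateField.isGalois_adjoin_of_pow_eq hζ hirr hu
  have : FiniteDimensional k⸨X⸩ k⸨X⸩⟮u⟯ :=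
    Module.finite_of_finrank_pos (hrank ▸ Nat.pos_of_ne_zero hr0)
  exact isTameExtension_of_isGalois (hrank ▸ hr)

theorem exists_isPrimitiveRoot_laurentSeries (p : ℕ) (k : Type*) [Field k] [CharP k p]
    [IsSepClosed k] {r : ℕ} (hr : r.Coprime p) (hp : p ≠ 1) :
    ∃ ζ : k⸨X⸩, IsPrimitiveRoot ζ r := by
  have : NeZero (r : k) := ⟨fun h =>
    hp (Nat.eq_one_of_dvd_coprimes hr ((CharP.cast_eq_zero_iff k p r).1 h) dvd_rfl)⟩
  obtain ⟨ζ, hζ⟩ := HasEnoughRootsOfUnity.exists_primitiveRoot k r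
  exact ⟨_, hζ.map_of_injective (HahnSeries.C (Γ := ℤ) (R := k)).injective⟩

theorem trace_evalInv_eq_zero {k : Type*} [Field k] {r : ℕ} {ζ : k⸨X⸩} (hζ : IsPrimitiveRoot ζ r)
    {u : SeparableClosure k⸨X⸩}
    (hu : u ^ r = algebraMap k⸨X⸩ (SeparableClosure k⸨X⸩) (HahnSeries.single 1 1))
    {φ : Polynomial k} (hφ : φ.coeff 0 = 0) (hs : φ.natDegree < r) :
    Algebra.trace k⸨X⸩ k⸨X⸩⟮u⟯ (evalInv u φ) = 0 := by
  rw [evalInv, Polynomial.eval₂_eq_sum_range, map_sum]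
  refine Finset.sum_eq_zero fun i hi => ?_
  rw [Finset.mem_range] at hi
  rw [RingHom.comp_apply, ← Algebra.smul_def, map_smul]
  obtain rfl | hi0 := eq_or_ne i 0
  · rw [hφ, map_zero, zero_smul]
  · rw [IntermediateField.trace_gen_inv_pow_eq_zero hζ
      (irreducible_X_pow_sub_C_single k (by lia)) hu hi0 (by lia), smul_zero]

theorem det_charRep_tprod {ℓ : ℕ} [Fact ℓ.Prime] {G V : Type*} [Group G] [AddCommGroup V]
    [Module (PadicAlgCl ℓ) V] (χ : G →* PadicAlgCl ℓ) {ρ : Representation (PadicAlgCl ℓ) G V}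
    {g : G} (hg : ρ g = 1) : LinearMap.det ((charRep χ).tprod ρ g) =
      χ g ^ Module.finrank (PadicAlgCl ℓ) (PadicAlgCl ℓ ⊗[PadicAlgCl ℓ] V) := by
  rw [← mul_one (χ g ^ _), ← LinearMap.det_id (A := PadicAlgCl ℓ)
    (M := PadicAlgCl ℓ ⊗[PadicAlgCl ℓ] V), ← LinearMap.det_smul]
  congr 1
  ext v
  simp [charRep, hg, TensorProduct.smul_tmul']

end Formal

theorem corollary4p2
    (p : ℕ) [Fact p.Prime] (ℓ : ℕ) [Fact ℓ.Prime] (hℓ : ℓ ≠ p)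
    (k : Type*) [Field k] [CharP k p] [Algebra (ZMod p) k] [IsAlgClosure (ZMod p) k]
    (ψ : AddChar (ZMod p) (PadicAlgCl ℓ)) (hψ : ψ ≠ 1)
    (r : ℕ) (hr : r.Coprime p)
    (u : SeparableClosure k⸨X⸩)
    (hu : u ^ r = algebraMap k⸨X⸩ (SeparableClosure k⸨X⸩) (HahnSeries.single 1 1))
    (φ : Polynomial k) (hφ : φ.coeff 0 = 0) (hs : φ.natDegree < r)
    {V : Type*} [AddCommGroup V] [Module (PadicAlgCl ℓ) V]
    (H : Representation (PadicAlgCl ℓ) (Formal.InertiaCover u) V)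
    (hH : Formal.IsTamelyRamified (Formal.wildSubgroupCover p u) H) :
    let ρ := Formal.pushforward u
      ((Formal.artinSchreierSheaf p (SeparableClosure k⸨X⸩) ψ (Formal.evalInv u φ)).tprod H)
    Algebra.trace k⸨X⸩ k⸨X⸩⟮u⟯ (Formal.evalInv u φ) = 0 ∧
      Formal.IsEllAdic ρ ∧
      Formal.IsTamelyRamified (Formal.wildSubgroup p k) (Formal.detRep ρ) := by
  intro ρ
  have : IsAlgClosed k := IsAlgClosure.isAlgClosed (ZMod p)
  obtain ⟨ζ, hζ⟩ :=
    Formal.exists_isPrimitiveRoot_laurentSeries p k hr (Fact.out : p.Prime).ne_one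
  have htame := Formal.isTameExtension_adjoin hr (by lia) hζ hu
  have := htame.1
  have := IntermediateField.isGalois_adjoin_of_pow_eq hζ
    (Formal.irreducible_X_pow_sub_C_single k (by lia)) hu
  have hV := hH.finite
  obtain ⟨c, hc, hbij⟩ := IntermediateField.exists_section_restrict k⸨X⸩⟮u⟯
  have htrace := Formal.trace_evalInv_eq_zero hζ hu hφ hs
  have hρ : Formal.IsEllAdic ρ :=
    (hH.toIsEllAdic.charRep_tprod
      (Formal.continuous_artinSchreier ψ.toMonoidHom (Formal.evalInv u φ))).ind
      (IntermediateField.nhds_one_le_map_restrictScalarsHom _) hbij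
  refine ⟨htrace, hρ, hρ.detRep, fun σ hσ => ?_⟩
  have hconj (τ) : c τ * σ * (c τ)⁻¹ ∈ Formal.wildSubgroup p k :=
    Formal.wildInertia_normal.conj_mem σ hσ (c τ)
  choose g hg using fun τ => IntermediateField.exists_restrictScalarsHom_eq k⸨X⸩⟮u⟯
    (Formal.mem_wildInertia_iff.1 (hconj τ) _ htame)
  have hgH (τ) : H (g τ) = 1 := hH.tame _
    (Formal.mem_wildInertia_of_restrictScalarsHom htame (by rw [hg]; exact hconj τ))
  classical
  have hdet : LinearMap.det (ρ σ) = 1 := by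
    rw [Representation.det_ind _ _ c hbij hg]
    have h := Formal.sum_artinSchreierDiff_conj (p := p) htrace hc hg
    have hprod : ∏ τ, (ψ.toMonoidHom.comp (Formal.artinSchreierHom p (SeparableClosure k⸨X⸩)
        (Formal.evalInv u φ))) (g τ) = 1 := by
      simp only [MonoidHom.comp_apply]
      rw [← map_prod, ← map_one ψ.toMonoidHom]
      exact congrArg ψ.toMonoidHom h
    refine (Finset.prod_congr rfl fun τ _ => Formal.det_charRep_tprod _ (hgH τ)).trans ?_
    rw [Finset.prod_pow, hprod, one_pow]
  ext
  simp [Formal.detRep, Formal.charRep, hdet]
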